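/- Let $d\in\mathbb N$, let $\Omega\subset\mathbb R^d$ be an open set (bounded or not, possibly $\mathbb R^d$) with Lipschitz boundary, i.e. near each boundary point $\Omega$ is, after a rigid motion, the set above the graph of a Lipschitz function. For $\rho>0$ put $\Omega_\rho:=\{x\in\Omega:\operatorname{dist}(x,\partial\Omega)>\rho\}$ (with $\operatorname{dist}(x,\emptyset)=\infty$) and $B_r:=\{\xi\in\mathbb R^d:|\xi|<r\}$. Let $k\ge r>0$. Then there is a constant $C>0$, depending only on $\Omega,k,r$ (in particular neither on $\varepsilon$ nor on $M$), with the following property. Let $M\ge 0$ and let $\{u_\varepsilon\}_{\varepsilon\in I}$, $I\subset(0,\infty)$, be a family of real- or complex-valued functions that is bounded in $L^2(\Omega)$ and satisfies $$\int_{\Omega_{k\varepsilon}}\int_{B_r}\left|\frac{u_\varepsilon(x+\varepsilon\xi)-u_\varepsilon(x)}{\varepsilon}\right|^2 d\xi\,dx\le M\qquad\text{for all }\varepsilon\in I.$$ Then there is a family $\{w_\varepsilon\}_{\varepsilon\in I}$ with $w_\varepsilon\in C^\infty(\Omega_{k\varepsilon})\cap H^1(\Omega_{k\varepsilon})$, with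 $\|w_\varepsilon\|_{H^1(\Omega_{k\varepsilon})}$ bounded uniformly in $\varepsilon\in I$, such that for all $\varepsilon\in I$ $$\|u_\varepsilon-w_\varepsilon\|_{L^2(\Omega_{k\varepsilon})}\le C\sqrt M\,\varepsilon,\qquad \|w_\varepsilon\|_{H^1(\Omega_{k\varepsilon})}\le C\bigl(\sqrt M+\|u_\varepsilon\|_{L^2(\Omega)}\bigr).$$ Moreover, every sequence in $I$ converging to $0$ has a subsequence $(\varepsilon_n)$ for which there is $u\in H^1(\Omega)$ such that, for every open set $\Omega'$ whose closure is compact and contained in $\Omega$, as $n\to\infty$, $$u_{\varepsilon_n}\to u\ \text{ strongly in }L^2(\Omega'),\qquad w_{\varepsilon_n}\to u\ \text{ strongly in }L^2(\Omega')\text{ and weakly in }H^1(\Omega').$$ -/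

import Mathlib

open MeasureTheory Filter Topology
open scoped NNReal ENNReal ContDiff

/-- `Ω` has Lipschitz boundary: near each of its boundary points, `Ω` is the set of points lying
strictly above the graph of a Lipschitz function of the variables orthogonal to some unit
vector `ν`. No uniformity in the boundary point and no boundedness of `Ω` is required. -/
def HasLipschitzBoundary {d : ℕ} (Ω : Set (EuclideanSpace ℝ (Fin d))) : Prop :=
  ∀ x ∈ frontier Ω, ∃ (ν : EuclideanSpace ℝ (Fin d))
    (g : (Submodule.span ℝ {ν})ᗮ → ℝ) (L : ℝ≥0) (U : Set (EuclideanSpace ℝ (Fin d))),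
    ‖ν‖ = 1 ∧ LipschitzWith L g ∧ U ∈ 𝓝 x ∧
      ∀ y ∈ U, (y ∈ Ω ↔ g ((Submodule.span ℝ {ν})ᗮ.orthogonalProjectionOnto y) < inner ℝ ν y)

/-- `A_ρ = {x ∈ A : dist (x, ∂A) > ρ}`; the extended distance is used, so that the distance to an
empty boundary is infinite (for instance, `innerSet univ ρ = univ`). -/
def innerSet {d : ℕ} (A : Set (EuclideanSpace ℝ (Fin d))) (ρ : ℝ) :
    Set (EuclideanSpace ℝ (Fin d)) :=
  {x ∈ A | ENNReal.ofReal ρ < Metric.infEDist x (frontier A)}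

/-- The family of classical partial derivatives `∂ᵢ f`. -/
noncomputable def partials {d : ℕ} {F : Type*} [NormedAddCommGroup F] [NormedSpace ℝ F]
    (f : EuclideanSpace ℝ (Fin d) → F) : Fin d → EuclideanSpace ℝ (Fin d) → F :=
  fun i x => fderiv ℝ f x (EuclideanSpace.single i 1)

/-- `u ∈ H¹(Ω)` with weak gradient `Du = (Du 1, …, Du d)` (for an open set `Ω`). -/
structure IsH1 {d : ℕ} {𝕜 : Type*} [RCLike 𝕜] (Ω : Set (EuclideanSpace ℝ (Fin d)))
    (u : EuclideanSpace ℝ (Fin d) → 𝕜) (Du : Fin d → EuclideanSpace ℝ (Fin d) → 𝕜) : Prop where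
  memLp : MemLp u 2 (volume.restrict Ω)
  grad_memLp : ∀ i, MemLp (Du i) 2 (volume.restrict Ω)
  weak_deriv : ∀ (i : Fin d) (φ : EuclideanSpace ℝ (Fin d) → ℝ),
    ContDiff ℝ ∞ φ → HasCompactSupport φ → tsupport φ ⊆ Ω →
      ∫ x in Ω, partials φ i x • u x = -∫ x in Ω, φ x • Du i x

/-- The `H¹(Ω)` norm `(‖u‖² + ∑ᵢ ‖Du i‖²)^(1/2)`, with `L²(Ω)` norms on the right. -/
noncomputable def h1Norm {d : ℕ} {𝕜 : Type*} [RCLike 𝕜] (Ω : Set (EuclideanSpace ℝ (Fin d)))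
    (u : EuclideanSpace ℝ (Fin d) → 𝕜) (Du : Fin d → EuclideanSpace ℝ (Fin d) → 𝕜) : ℝ≥0∞ :=
  (eLpNorm u 2 (volume.restrict Ω) ^ 2 +
    ∑ i, eLpNorm (Du i) 2 (volume.restrict Ω) ^ 2) ^ (1 / 2 : ℝ)

/-- The `H¹(Ω)` inner product `∫ u v̄ + ∑ᵢ ∫ ∂ᵢu ∂ᵢv̄` (linear in `u`). -/
noncomputable def h1Inner {d : ℕ} {𝕜 : Type*} [RCLike 𝕜] (Ω : Set (EuclideanSpace ℝ (Fin d)))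
    (u : EuclideanSpace ℝ (Fin d) → 𝕜) (Du : Fin d → EuclideanSpace ℝ (Fin d) → 𝕜)
    (v : EuclideanSpace ℝ (Fin d) → 𝕜) (Dv : Fin d → EuclideanSpace ℝ (Fin d) → 𝕜) : 𝕜 :=
  (∫ x in Ω, inner 𝕜 (v x) (u x)) + ∑ i, ∫ x in Ω, inner 𝕜 (Dv i x) (Du i x)

/-- Weak convergence in the Hilbert space `H¹(Ω)` of a sequence `w n` (with gradients `Dw n`),
whose terms need to lie in `H¹(Ω)` for large `n` only, to `u` (with gradient `Du`). -/
def WeakTendstoH1 {d : ℕ} {𝕜 : Type*} [RCLike 𝕜] (Ω : Set (EuclideanSpace ℝ (Fin d)))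
    (w : ℕ → EuclideanSpace ℝ (Fin d) → 𝕜) (Dw : ℕ → Fin d → EuclideanSpace ℝ (Fin d) → 𝕜)
    (u : EuclideanSpace ℝ (Fin d) → 𝕜) (Du : Fin d → EuclideanSpace ℝ (Fin d) → 𝕜) : Prop :=
  (∀ᶠ n in atTop, IsH1 Ω (w n) (Dw n)) ∧ IsH1 Ω u Du ∧
    ∀ v Dv, IsH1 Ω v Dv →
      Tendsto (fun n => h1Inner Ω (w n) (Dw n) v Dv) atTop (𝓝 (h1Inner Ω u Du v Dv))

section Hilbert

variable {𝕜 H : Type*} [RCLike 𝕜] [NormedAddCommGroup H] [InnerProductSpace 𝕜 H] [CompleteSpace H]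

/-- Bounded sequences in a separable Hilbert space have weakly convergent subsequences. -/
theorem exists_subseq_weak_tendsto [TopologicalSpace.SeparableSpace H] (x : ℕ → H) (B : ℝ)
    (hB : ∀ n, ‖x n‖ ≤ B) :
    ∃ (s : ℕ → ℕ) (a : H), StrictMono s ∧
      ∀ y, Tendsto (fun n => inner 𝕜 y (x (s n))) atTop (𝓝 (inner 𝕜 y a)) := by
  let f : ℕ → WeakDual 𝕜 H := fun n =>
    WeakDual.toStrongDual.symm (InnerProductSpace.toDual 𝕜 H (x n))
  obtain ⟨g, -, s, hs, hg⟩ := WeakDual.isSeqCompact_closedBall 𝕜 H 0 B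
    (x := f) (fun n => by simpa [f] using hB n)
  refine ⟨s, (InnerProductSpace.toDual 𝕜 H).symm (WeakDual.toStrongDual g), hs, fun y => ?_⟩
  have h1 : Tendsto (fun n => f (s n) y) atTop (𝓝 (g y)) :=
    ((WeakDual.eval_continuous y).tendsto g).comp hg
  have h2 := ((RCLike.continuous_conj (K := 𝕜)).tendsto _).comp h1
  have h3 : (starRingEnd 𝕜) (g y) =
      inner 𝕜 y ((InnerProductSpace.toDual 𝕜 H).symm (WeakDual.toStrongDual g)) := by
    rw [← inner_conj_symm, InnerProductSpace.toDual_symm_apply]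
    rfl
  rw [h3] at h2
  refine h2.congr fun n => ?_
  simp only [Function.comp, f]
  rw [← inner_conj_symm]
  rfl

/-- Simultaneous extraction of weakly convergent subsequences for a finite family. -/
theorem exists_subseq_weak_tendsto_finset [TopologicalSpace.SeparableSpace H] {ι : Type*}
    (x : ι → ℕ → H) (B : ℝ) (hB : ∀ i n, ‖x i n‖ ≤ B) (t : Finset ι) :
    ∃ s : ℕ → ℕ, StrictMono s ∧ ∀ i ∈ t, ∃ a : H,
      ∀ y, Tendsto (fun n => inner 𝕜 y (x i (s n))) atTop (𝓝 (inner 𝕜 y a)) := by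
  classical
  induction t using Finset.induction_on with
  | empty => exact ⟨id, strictMono_id, by simp⟩
  | insert j t hj ih =>
    obtain ⟨s, hs, h⟩ := ih
    obtain ⟨s', a, hs', ha⟩ := exists_subseq_weak_tendsto (𝕜 := 𝕜) (fun n => x j (s n)) B
      (fun n => hB _ _)
    refine ⟨s ∘ s', hs.comp hs', fun i hi => ?_⟩
    rcases Finset.mem_insert.1 hi with rfl | hi
    · exact ⟨a, ha⟩
    · obtain ⟨b, hb⟩ := h i hi
      exact ⟨b, fun y => (hb y).comp hs'.tendsto_atTop⟩

/-- A weakly convergent sequence which can be approximated uniformly by norm convergent sequences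
converges in norm. -/
theorem tendsto_of_weak_tendsto_of_approx {x : ℕ → H} {a : H}
    (hw : ∀ y, Tendsto (fun n => inner 𝕜 y (x n)) atTop (𝓝 (inner 𝕜 y a)))
    (happ : ∀ η > 0, ∃ (y : ℕ → H) (b : H), Tendsto y atTop (𝓝 b) ∧
      ∀ᶠ n in atTop, ‖x n - y n‖ ≤ η) :
    Tendsto x atTop (𝓝 a) := by
  have hc : CauchySeq x := by
    rw [Metric.cauchySeq_iff']
    intro η hη
    obtain ⟨y, b, hy, hxy⟩ := happ (η / 5) (by positivity)
    have hb : ∀ᶠ n in atTop, dist (y n) b < η / 5 := (Metric.tendsto_nhds.1 hy) _ (by positivity)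
    obtain ⟨N, hN⟩ := eventually_atTop.1 (hxy.and hb)
    have key : ∀ n ≥ N, dist (x n) b < 2 * (η / 5) := fun n hn => by
      have := dist_triangle (x n) (y n) b
      have h1 := (hN n hn).1
      have h2 := (hN n hn).2
      rw [← dist_eq_norm] at h1
      linarith
    refine ⟨N, fun n hn => ?_⟩
    have := dist_triangle_right (x n) (x N) b
    have h1 := key n hn
    have h2 := key N le_rfl
    linarith
  obtain ⟨c, hcx⟩ := cauchySeq_tendsto_of_complete hc
  have hca : c = a := by
    refine ext_inner_left 𝕜 fun y => tendsto_nhds_unique ?_ (hw y)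
    exact tendsto_const_nhds.inner hcx
  exact hca ▸ hcx

end Hilbert

section L2

variable {𝕜 α : Type*} [RCLike 𝕜] [MeasurableSpace α] {μ : Measure α}

theorem inner_toLp {f g : α → 𝕜} (hf : MemLp f 2 μ) (hg : MemLp g 2 μ) :
    inner 𝕜 (hf.toLp f) (hg.toLp g) = ∫ x, inner 𝕜 (f x) (g x) ∂μ := by
  rw [L2.inner_def]
  refine integral_congr_ae ?_
  filter_upwards [hf.coeFn_toLp, hg.coeFn_toLp] with x h1 h2
  rw [h1, h2]

theorem MemLp.norm_toLp_le {f : α → 𝕜} (hf : MemLp f 2 μ) {B : ℝ≥0}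
    (h : eLpNorm f 2 μ ≤ B) : ‖hf.toLp f‖ ≤ B := by
  rw [Lp.norm_toLp]
  exact ENNReal.toReal_le_of_le_ofReal B.2 (by simpa using h)

theorem eLpNorm_two_sq {F : Type*} [NormedAddCommGroup F] (f : α → F) (μ : Measure α) :
    eLpNorm f 2 μ ^ 2 = ∫⁻ x, ‖f x‖ₑ ^ 2 ∂μ := by
  rw [eLpNorm_eq_lintegral_rpow_enorm_toReal (by simp) (by simp), ← ENNReal.rpow_natCast,
    ← ENNReal.rpow_mul]
  simp

theorem eLpNorm_two_le_iff {F : Type*} [NormedAddCommGroup F] {f : α → F} {b : ℝ≥0∞} :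
    eLpNorm f 2 μ ≤ b ↔ ∫⁻ x, ‖f x‖ₑ ^ 2 ∂μ ≤ b ^ 2 := by
  rw [← eLpNorm_two_sq, ENNReal.pow_le_pow_left_iff two_ne_zero]

/-- Cauchy-Schwarz for the integral of a product with a bounded kernel supported in `s`. -/
theorem enorm_setIntegral_smul_sq_le {q : α → ℝ} {f : α → 𝕜} {s : Set α} {K : ℝ≥0}
    (hq : ∀ x, ‖q x‖ₑ ≤ K) (hqs : ∀ x ∉ s, q x = 0) (hf : AEStronglyMeasurable f μ) :
    ‖∫ x, q x • f x ∂μ‖ₑ ^ 2 ≤ K ^ 2 * μ s * ∫⁻ x in s, ‖f x‖ₑ ^ 2 ∂μ := by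
  have h1 : ‖∫ x, q x • f x ∂μ‖ₑ ≤ K * ∫⁻ x in s, ‖f x‖ₑ ∂μ := by
    calc ‖∫ x, q x • f x ∂μ‖ₑ = ‖∫ x in s, q x • f x ∂μ‖ₑ := by
          rw [setIntegral_eq_integral_of_forall_compl_eq_zero]
          intro x hx
          simp [hqs x hx]
      _ ≤ ∫⁻ x in s, ‖q x • f x‖ₑ ∂μ := enorm_integral_le_lintegral_enorm _
      _ ≤ ∫⁻ x in s, K * ‖f x‖ₑ ∂μ := by
          refine lintegral_mono fun x => ?_
          rw [enorm_smul]
          gcongr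
          exact hq x
      _ = K * ∫⁻ x in s, ‖f x‖ₑ ∂μ := lintegral_const_mul' _ _ (by simp)
  have h2 : (∫⁻ x in s, ‖f x‖ₑ ∂μ) ^ 2 ≤ μ s * ∫⁻ x in s, ‖f x‖ₑ ^ 2 ∂μ := by
    have := ENNReal.lintegral_mul_le_Lp_mul_Lq (μ.restrict s) (p := 2) (q := 2)
      (Real.HolderConjugate.two_two) (f := fun _ => 1) (g := fun x => ‖f x‖ₑ)
      aemeasurable_const hf.restrict.enorm
    simp only [Pi.mul_apply, one_mul, ENNReal.one_rpow, lintegral_const, Measure.restrict_apply,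
      MeasurableSet.univ, Set.univ_inter] at this
    calc _ ≤ _ := pow_le_pow_left' this 2
      _ = _ := by
        rw [mul_pow, ← ENNReal.rpow_natCast, ← ENNReal.rpow_natCast, ← ENNReal.rpow_mul,
          ← ENNReal.rpow_mul]
        simp
  calc _ ≤ (K * ∫⁻ x in s, ‖f x‖ₑ ∂μ) ^ 2 := pow_le_pow_left' h1 2
    _ ≤ K ^ 2 * (μ s * ∫⁻ x in s, ‖f x‖ₑ ^ 2 ∂μ) := by rw [mul_pow]; gcongr
    _ = _ := by ring

end L2

section Mollify

variable {𝕜 : Type*} [RCLike 𝕜] {d : ℕ}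

/-- The average `∫ q(ξ) v(x + εξ) dξ` of `v` at scale `ε` with weight `q`. -/
noncomputable def mollify (q : EuclideanSpace ℝ (Fin d) → ℝ) (ε : ℝ)
    (v : EuclideanSpace ℝ (Fin d) → 𝕜) (x : EuclideanSpace ℝ (Fin d)) : 𝕜 :=
  ∫ ξ, q ξ • v (x + ε • ξ)

variable {q : EuclideanSpace ℝ (Fin d) → ℝ} {ε : ℝ} {v : EuclideanSpace ℝ (Fin d) → 𝕜}

theorem mollify_eq_convolution (hε : ε ≠ 0) (q : EuclideanSpace ℝ (Fin d) → ℝ)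
    (v : EuclideanSpace ℝ (Fin d) → 𝕜) :
    mollify q ε v = fun x => |((-ε) ^ d)⁻¹| •
      (convolution (fun t => q ((-ε⁻¹) • t)) v (ContinuousLinearMap.lsmul ℝ ℝ) volume x) := by
  ext x
  have := Measure.integral_comp_smul (μ := (volume : Measure (EuclideanSpace ℝ (Fin d))))
    (fun t => q ((-ε⁻¹) • t) • v (x - t)) (-ε)
  rw [finrank_euclideanSpace_fin] at this
  simp only [convolution, ContinuousLinearMap.lsmul_apply, ← this, mollify]
  refine integral_congr_ae (Eventually.of_forall fun ξ => ?_)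
  simp [smul_smul, hε]

theorem HasCompactSupport.comp_const_smul (hq : HasCompactSupport q) {c : ℝ} (hc : c ≠ 0) :
    HasCompactSupport fun t => q (c • t) :=
  hq.comp_homeomorph (Homeomorph.smulOfNeZero c hc)

theorem contDiff_mollify (hε : ε ≠ 0) (hq : ContDiff ℝ ∞ q) (hqc : HasCompactSupport q)
    (hv : LocallyIntegrable v) : ContDiff ℝ ∞ (mollify q ε v) := by
  rw [mollify_eq_convolution hε]
  refine ContDiff.const_smul _ ?_
  refine HasCompactSupport.contDiff_convolution_left _ (hqc.comp_const_smul (by simpa using hε))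
    ?_ hv
  exact hq.comp (contDiff_id.const_smul _)

theorem fderiv_mollify (hε : ε ≠ 0) (hq : ContDiff ℝ ∞ q) (hqc : HasCompactSupport q)
    (hv : LocallyIntegrable v) (x e : EuclideanSpace ℝ (Fin d)) :
    fderiv ℝ (mollify q ε v) x e = (-ε⁻¹) • mollify (fun ξ => fderiv ℝ q ξ e) ε v x := by
  have hc : (-ε⁻¹) ≠ 0 := by simpa using hε
  have hq1 : ContDiff ℝ 1 (fun t => q ((-ε⁻¹) • t)) :=
    (hq.comp (contDiff_id.const_smul _)).of_le (mod_cast le_top)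
  have hqc1 := hqc.comp_const_smul hc
  have h := (hqc1.hasFDerivAt_convolution_left (ContinuousLinearMap.lsmul ℝ ℝ) hq1 hv x).const_smul
    |((-ε) ^ d)⁻¹|
  rw [mollify_eq_convolution hε, mollify_eq_convolution hε]
  have h' := h.fderiv
  have h2 : ∀ t, fderiv ℝ (fun t => q ((-ε⁻¹) • t)) t = (-ε⁻¹) • fderiv ℝ q ((-ε⁻¹) • t) :=
    fun t => fderiv_comp_smul _
  have h3 : (convolution (fderiv ℝ fun t => q ((-ε⁻¹) • t)) v
      ((ContinuousLinearMap.lsmul ℝ ℝ).precompL _) volume x) e =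
      ∫ t, (fderiv ℝ (fun t => q ((-ε⁻¹) • t)) t e) • v (x - t) := by
    have := (hqc1.fderiv ℝ).convolutionExists_left
      ((ContinuousLinearMap.lsmul ℝ ℝ).precompL (EuclideanSpace ℝ (Fin d)))
      (hq1.continuous_fderiv one_ne_zero) hv x
    exact ContinuousLinearMap.integral_apply this.integrable e
  erw [h']
  rw [smul_apply, h3, smul_comm (-ε⁻¹)]
  congr 1
  simp only [convolution, h2, smul_apply, ContinuousLinearMap.lsmul_apply,
    smul_assoc]
  rw [integral_smul]

theorem integral_fderiv_eq_zero (hq : ContDiff ℝ ∞ q) (hqc : HasCompactSupport q)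
    (e : EuclideanSpace ℝ (Fin d)) : ∫ ξ, fderiv ℝ q ξ e = 0 := by
  have h1 : Integrable (fun ξ => fderiv ℝ q ξ e) :=
    ((hq.continuous_fderiv (by simp)).clm_apply continuous_const).integrable_of_hasCompactSupport
      (hqc.fderiv_apply ℝ e)
  have := integral_mul_fderiv_eq_neg_fderiv_mul_of_integrable
    (μ := (volume : Measure (EuclideanSpace ℝ (Fin d)))) (𝕜 := ℝ)
    (f := q) (g := fun _ => 1) (v := e)
    (by simpa using h1) (by simp)
    (by simpa using hq.continuous.integrable_of_hasCompactSupport hqc)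
    (fun x _ => (hq.differentiable (by simp)) x)
    (fun x _ => differentiableAt_const _)
  simpa using this.symm

theorem MemLp.locallyIntegrable_two (hv : MemLp v 2 volume) : LocallyIntegrable v :=
  hv.locallyIntegrable one_le_two

theorem integrable_smul_comp_affine (hε : ε ≠ 0) (hq : Continuous q) (hqc : HasCompactSupport q)
    (hv : MemLp v 2 volume) (x : EuclideanSpace ℝ (Fin d)) :
    Integrable fun ξ => q ξ • v (x + ε • ξ) := by
  have h1 : LocallyIntegrable fun t => v (x + t) :=
    MemLp.locallyIntegrable_two (hv.comp_measurePreserving (measurePreserving_add_left volume x))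
  have h2 := h1.integrable_smul_left_of_hasCompactSupport
    (hq.comp (continuous_const_smul ε⁻¹)) (hqc.comp_const_smul (inv_ne_zero hε))
  have h3 := (integrable_comp_smul_iff volume _ hε).2 h2
  simpa [smul_smul, hε] using h3

theorem mollify_sub_eq (hε : ε ≠ 0) (hq : Continuous q) (hqc : HasCompactSupport q)
    (hv : MemLp v 2 volume) (x : EuclideanSpace ℝ (Fin d)) :
    mollify q ε v x - (∫ ξ, q ξ) • v x = ∫ ξ, q ξ • (v (x + ε • ξ) - v x) := by
  simp only [smul_sub]
  rw [integral_sub (integrable_smul_comp_affine hε hq hqc hv x)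
    ((hq.integrable_of_hasCompactSupport hqc).smul_const _), integral_smul_const]
  rfl

variable {s : Set (EuclideanSpace ℝ (Fin d))} {K b : ℝ≥0}

theorem eLpNorm_mollify_le (hK : ∀ x, ‖q x‖ₑ ≤ K) (hqs : ∀ x ∉ s, q x = 0)
    (hb : volume s ≤ b) (hv : StronglyMeasurable v) :
    eLpNorm (mollify q ε v) 2 volume ≤ K * b * eLpNorm v 2 volume := by
  rw [eLpNorm_two_le_iff]
  have hm : Measurable fun p : EuclideanSpace ℝ (Fin d) × EuclideanSpace ℝ (Fin d) =>
      ‖v (p.1 + ε • p.2)‖ₑ ^ 2 :=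
    ((hv.comp_measurable (by fun_prop)).enorm).pow_const 2
  calc ∫⁻ x, ‖mollify q ε v x‖ₑ ^ 2
      ≤ ∫⁻ x, K ^ 2 * volume s * ∫⁻ ξ in s, ‖v (x + ε • ξ)‖ₑ ^ 2 :=
        lintegral_mono fun x => enorm_setIntegral_smul_sq_le hK hqs
          (hv.comp_measurable (by fun_prop)).aestronglyMeasurable
    _ = K ^ 2 * volume s * ∫⁻ x, ∫⁻ ξ in s, ‖v (x + ε • ξ)‖ₑ ^ 2 :=
        lintegral_const_mul _ hm.lintegral_prod_right'
    _ = K ^ 2 * volume s * (volume s * ∫⁻ x, ‖v x‖ₑ ^ 2) := by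
        rw [lintegral_lintegral_swap (f := fun x ξ => ‖v (x + ε • ξ)‖ₑ ^ 2) hm.aemeasurable]
        congr 1
        have h1 (ξ : EuclideanSpace ℝ (Fin d)) : ∫⁻ x, ‖v (x + ε • ξ)‖ₑ ^ 2 = ∫⁻ x, ‖v x‖ₑ ^ 2 :=
          lintegral_add_right_eq_self (fun x => ‖v x‖ₑ ^ 2) (ε • ξ)
        simp [h1, mul_comm]
    _ ≤ K ^ 2 * b * (b * ∫⁻ x, ‖v x‖ₑ ^ 2) := by gcongr
    _ = (K * b * eLpNorm v 2 volume) ^ 2 := by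
        rw [mul_pow _ (eLpNorm _ _ _), eLpNorm_two_sq]
        ring

theorem eLpNorm_mollify_sub_le (hε : 0 < ε) (hq : Continuous q) (hqc : HasCompactSupport q)
    (hK : ∀ x, ‖q x‖ₑ ≤ K) (hqs : ∀ x ∉ s, q x = 0) (hb : volume s ≤ b)
    (hvL : MemLp v 2 volume) (hv : StronglyMeasurable v)
    {A : Set (EuclideanSpace ℝ (Fin d))} {M : ℝ} (hM : 0 ≤ M)
    (h : ∫⁻ x in A, ∫⁻ ξ in s, ‖ε⁻¹ • (v (x + ε • ξ) - v x)‖ₑ ^ 2 ≤ ENNReal.ofReal M) :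
    eLpNorm (fun x => mollify q ε v x - (∫ ξ, q ξ) • v x) 2 (volume.restrict A) ≤
      K * (1 + b) * ENNReal.ofReal (√M) * ENNReal.ofReal ε := by
  rw [eLpNorm_two_le_iff]
  have hm : Measurable fun p : EuclideanSpace ℝ (Fin d) × EuclideanSpace ℝ (Fin d) =>
      ‖ε⁻¹ • (v (p.1 + ε • p.2) - v p.1)‖ₑ ^ 2 :=
    ((((hv.comp_measurable (by fun_prop)).sub
      (hv.comp_measurable (by fun_prop))).const_smul _).enorm).pow_const 2
  calc ∫⁻ x in A, ‖mollify q ε v x - (∫ ξ, q ξ) • v x‖ₑ ^ 2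
      ≤ ∫⁻ x in A, K ^ 2 * volume s * ENNReal.ofReal ε ^ 2 *
          ∫⁻ ξ in s, ‖ε⁻¹ • (v (x + ε • ξ) - v x)‖ₑ ^ 2 := by
        refine lintegral_mono fun x => ?_
        simp only
        rw [mollify_sub_eq hε.ne' hq hqc hvL]
        have h1 := enorm_setIntegral_smul_sq_le (μ := volume) hK hqs
          (f := fun ξ => v (x + ε • ξ) - v x)
          ((hv.comp_measurable (by fun_prop)).sub stronglyMeasurable_const).aestronglyMeasurable
        refine h1.trans ?_
        rw [mul_assoc (K ^ 2 * volume s), ← lintegral_const_mul' (ENNReal.ofReal ε ^ 2) _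
          (by finiteness)]
        refine mul_le_mul_right (lintegral_mono fun ξ => ?_) _
        simp only
        rw [← mul_pow, enorm_smul, ← mul_assoc, Real.enorm_eq_ofReal (by positivity),
          ← ENNReal.ofReal_mul hε.le, mul_inv_cancel₀ hε.ne']
        simp
    _ = K ^ 2 * volume s * ENNReal.ofReal ε ^ 2 *
          ∫⁻ x in A, ∫⁻ ξ in s, ‖ε⁻¹ • (v (x + ε • ξ) - v x)‖ₑ ^ 2 :=
        lintegral_const_mul _ hm.lintegral_prod_right'
    _ ≤ K ^ 2 * b * ENNReal.ofReal ε ^ 2 * ENNReal.ofReal M := by gcongr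
    _ ≤ K ^ 2 * (1 + b) ^ 2 * ENNReal.ofReal ε ^ 2 * ENNReal.ofReal (√M) ^ 2 := by
        have : (b : ℝ≥0∞) ≤ (1 + b) ^ 2 := by
          have : b ≤ (1 + b) ^ 2 := by nlinarith [b.2, sq_nonneg (b : ℝ)]
          exact_mod_cast this
        rw [← ENNReal.ofReal_pow (Real.sqrt_nonneg M), Real.sq_sqrt hM]
        gcongr
    _ = _ := by ring

end Mollify

section InnerSet

variable {d : ℕ}

theorem IsPreconnected.subset_of_disjoint_frontier {X : Type*} [TopologicalSpace X] {s t : Set X}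
    (hs : IsPreconnected s) (ht : IsOpen t) (hne : (s ∩ t).Nonempty)
    (h : Disjoint s (frontier t)) : s ⊆ t := by
  refine hs.subset_left_of_subset_union (v := (closure t)ᶜ) ht isClosed_closure.isOpen_compl
    (Set.disjoint_compl_right_iff_subset.2 subset_closure) (fun x hx => ?_) hne
  by_cases hxt : x ∈ t
  · exact Or.inl hxt
  · refine Or.inr fun hc => Set.disjoint_left.1 h hx ?_
    rw [ht.frontier_eq]
    exact ⟨hc, hxt⟩

theorem isOpen_innerSet {A : Set (EuclideanSpace ℝ (Fin d))} (hA : IsOpen A) (ρ : ℝ) :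
    IsOpen (innerSet A ρ) :=
  hA.inter (isOpen_lt continuous_const Metric.continuous_infEDist)

theorem innerSet_subset (A : Set (EuclideanSpace ℝ (Fin d))) (ρ : ℝ) : innerSet A ρ ⊆ A :=
  fun _ hx => hx.1

theorem add_mem_of_mem_innerSet {A : Set (EuclideanSpace ℝ (Fin d))} (hA : IsOpen A) {ρ : ℝ}
    {x z : EuclideanSpace ℝ (Fin d)} (hx : x ∈ innerSet A ρ) (hz : ‖z‖ ≤ ρ) : x + z ∈ A := by
  have hsub : Metric.closedBall x ‖z‖ ⊆ A := by
    refine (convex_closedBall x ‖z‖).isPreconnected.subset_of_disjoint_frontier hA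
      ⟨x, by simp, hx.1⟩ (Set.disjoint_left.2 fun y hy hyf => ?_)
    have h1 : Metric.infEDist x (frontier A) ≤ ENNReal.ofReal ρ := by
      refine (Metric.infEDist_le_edist_of_mem hyf).trans ?_
      rw [edist_dist, dist_comm]
      exact ENNReal.ofReal_le_ofReal ((Metric.mem_closedBall.1 hy).trans hz)
    exact absurd hx.2 (not_lt.2 h1)
  exact hsub (by simp)

/-- A compact subset of an open set is contained in all inner sets of small width. -/
theorem IsCompact.eventually_subset_innerSet {A s : Set (EuclideanSpace ℝ (Fin d))}
    (hA : IsOpen A) (hs : IsCompact s) (hsA : s ⊆ A) :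
    ∃ ρ₀ > 0, ∀ ρ < ρ₀, s ⊆ innerSet A ρ := by
  have hd : Disjoint s (frontier A) := by
    rw [hA.frontier_eq]
    exact Set.disjoint_left.2 fun x hx hx' => hx'.2 (hsA hx)
  obtain ⟨δ, hδ, h⟩ := Metric.exists_pos_forall_lt_edist hs isClosed_frontier hd
  refine ⟨δ, by exact_mod_cast hδ, fun ρ hρ x hx => ⟨hsA hx, ?_⟩⟩
  have h1 : ENNReal.ofReal ρ < δ := by
    rw [← ENNReal.ofReal_coe_nnreal]
    exact (ENNReal.ofReal_lt_ofReal_iff (by exact_mod_cast hδ)).2 hρ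
  refine h1.trans_le (Metric.le_infEDist.2 fun y hy => (h x hx y hy).le)

end InnerSet

section Sobolev

variable {𝕜 : Type*} [RCLike 𝕜] {d : ℕ}

theorem partials_eq_zero_of_notMem_tsupport {φ : EuclideanSpace ℝ (Fin d) → ℝ} (i : Fin d)
    {x : EuclideanSpace ℝ (Fin d)} (hx : x ∉ tsupport φ) : partials φ i x = 0 := by
  have : fderiv ℝ φ x = 0 := by
    by_contra h
    exact hx (support_fderiv_subset ℝ h)
  simp [partials, this]

theorem ContDiff.continuous_partials {F : Type*} [NormedAddCommGroup F] [NormedSpace ℝ F]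
    {w : EuclideanSpace ℝ (Fin d) → F} (hw : ContDiff ℝ ∞ w) (i : Fin d) :
    Continuous (partials w i) :=
  (hw.continuous_fderiv (by simp)).clm_apply continuous_const

theorem hasCompactSupport_partials {φ : EuclideanSpace ℝ (Fin d) → ℝ}
    (h : HasCompactSupport φ) (i : Fin d) : HasCompactSupport (partials φ i) :=
  h.fderiv_apply ℝ _

theorem isH1_of_contDiff {A : Set (EuclideanSpace ℝ (Fin d))}
    {w : EuclideanSpace ℝ (Fin d) → 𝕜} (hw : ContDiff ℝ ∞ w)
    (h : MemLp w 2 (volume.restrict A)) (h' : ∀ i, MemLp (partials w i) 2 (volume.restrict A)) :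
    IsH1 A w (partials w) := by
  refine ⟨h, h', fun i φ hφ hφc hφA => ?_⟩
  have hz : ∀ x ∉ A, φ x = 0 := fun x hx => image_eq_zero_of_notMem_tsupport fun hx' => hx (hφA hx')
  have hz' : ∀ x ∉ A, partials φ i x = 0 := fun x hx =>
    partials_eq_zero_of_notMem_tsupport i fun hx' => hx (hφA hx')
  rw [setIntegral_eq_integral_of_forall_compl_eq_zero (fun x hx => by simp [hz' x hx]),
    setIntegral_eq_integral_of_forall_compl_eq_zero (fun x hx => by simp [hz x hx])]
  rw [eq_neg_iff_add_eq_zero, add_comm, ← eq_neg_iff_add_eq_zero]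
  refine integral_smul_fderiv_eq_neg_fderiv_smul_of_integrable (𝕜 := ℝ) ?_ ?_ ?_
    (fun x _ => (hφ.differentiable (by simp)) x) (fun x _ => (hw.differentiable (by simp)) x)
  · exact ((hφ.continuous_partials i).smul hw.continuous).integrable_of_hasCompactSupport
      (hasCompactSupport_partials hφc i).smul_right
  · exact (hφ.continuous.smul (hw.continuous_partials i)).integrable_of_hasCompactSupport
      hφc.smul_right
  · exact (hφ.continuous.smul hw.continuous).integrable_of_hasCompactSupport hφc.smul_right

theorem IsH1.mono {A B : Set (EuclideanSpace ℝ (Fin d))} {w : EuclideanSpace ℝ (Fin d) → 𝕜}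
    {Dw : Fin d → EuclideanSpace ℝ (Fin d) → 𝕜} (h : IsH1 B w Dw) (hAB : A ⊆ B) :
    IsH1 A w Dw := by
  refine ⟨h.memLp.mono_measure (Measure.restrict_mono hAB le_rfl),
    fun i => (h.grad_memLp i).mono_measure (Measure.restrict_mono hAB le_rfl),
    fun i φ hφ hφc hφA => ?_⟩
  have hz : ∀ x ∉ A, φ x = 0 := fun x hx => image_eq_zero_of_notMem_tsupport fun hx' => hx (hφA hx')
  have hz' : ∀ x ∉ A, partials φ i x = 0 := fun x hx =>
    partials_eq_zero_of_notMem_tsupport i fun hx' => hx (hφA hx')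
  have := h.weak_deriv i φ hφ hφc (hφA.trans hAB)
  rw [setIntegral_eq_integral_of_forall_compl_eq_zero
      (fun x hx => by simp [hz' x fun hx' => hx (hAB hx')]),
    setIntegral_eq_integral_of_forall_compl_eq_zero
      (fun x hx => by simp [hz x fun hx' => hx (hAB hx')])] at this
  rwa [setIntegral_eq_integral_of_forall_compl_eq_zero (fun x hx => by simp [hz' x hx]),
    setIntegral_eq_integral_of_forall_compl_eq_zero (fun x hx => by simp [hz x hx])]

theorem h1Norm_le {A : Set (EuclideanSpace ℝ (Fin d))} {w : EuclideanSpace ℝ (Fin d) → 𝕜}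
    {Dw : Fin d → EuclideanSpace ℝ (Fin d) → 𝕜} {T : ℝ≥0∞}
    (h : eLpNorm w 2 (volume.restrict A) ≤ T)
    (h' : ∀ i, eLpNorm (Dw i) 2 (volume.restrict A) ≤ T) : h1Norm A w Dw ≤ (1 + d) * T := by
  have h1 : eLpNorm w 2 (volume.restrict A) ^ 2 + ∑ i, eLpNorm (Dw i) 2 (volume.restrict A) ^ 2 ≤
      ((1 + d) * T) ^ 2 := by
    calc _ ≤ T ^ 2 + ∑ _i : Fin d, T ^ 2 := by
          gcongr with i
          exact h' i
      _ = (1 + d) * T ^ 2 := by simp [add_mul]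
      _ ≤ (1 + d) ^ 2 * T ^ 2 := by
          gcongr
          have : (1 + d : ℕ) ≤ (1 + d) ^ 2 := by nlinarith
          exact_mod_cast this
      _ = _ := by ring
  calc h1Norm A w Dw ≤ (((1 + d) * T) ^ 2) ^ (1 / 2 : ℝ) := by unfold h1Norm; gcongr
    _ = _ := by
      rw [← ENNReal.rpow_natCast, ← ENNReal.rpow_mul]
      simp

theorem eLpNorm_le_h1Norm (A : Set (EuclideanSpace ℝ (Fin d)))
    (w : EuclideanSpace ℝ (Fin d) → 𝕜) (Dw : Fin d → EuclideanSpace ℝ (Fin d) → 𝕜) :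
    eLpNorm w 2 (volume.restrict A) ≤ h1Norm A w Dw ∧
      ∀ i, eLpNorm (Dw i) 2 (volume.restrict A) ≤ h1Norm A w Dw := by
  have key : ∀ a : ℝ≥0∞, a ^ 2 ≤ eLpNorm w 2 (volume.restrict A) ^ 2 +
      ∑ i, eLpNorm (Dw i) 2 (volume.restrict A) ^ 2 → a ≤ h1Norm A w Dw := fun a ha => by
    have : a = (a ^ 2) ^ (1 / 2 : ℝ) := by
      rw [← ENNReal.rpow_natCast, ← ENNReal.rpow_mul]
      simp
    rw [this]
    unfold h1Norm
    gcongr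
  refine ⟨key _ le_self_add, fun i => key _ (le_add_left ?_)⟩
  exact Finset.single_le_sum (f := fun i => eLpNorm (Dw i) 2 (volume.restrict A) ^ 2)
    (fun _ _ => zero_le) (Finset.mem_univ i)

end Sobolev

section Approximation

variable {𝕜 : Type*} [RCLike 𝕜] {d : ℕ}

theorem exists_stronglyMeasurable_extension {Ω : Set (EuclideanSpace ℝ (Fin d))}
    (hΩ : MeasurableSet Ω) {u : EuclideanSpace ℝ (Fin d) → 𝕜}
    (hu : MemLp u 2 (volume.restrict Ω)) :
    ∃ v : EuclideanSpace ℝ (Fin d) → 𝕜, StronglyMeasurable v ∧ MemLp v 2 volume ∧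
      (∀ᵐ x, x ∈ Ω → v x = u x) ∧ eLpNorm v 2 volume = eLpNorm u 2 (volume.restrict Ω) := by
  have hae : u =ᵐ[volume.restrict Ω] hu.1.mk u := hu.1.ae_eq_mk
  refine ⟨Ω.indicator (hu.1.mk u), hu.1.stronglyMeasurable_mk.indicator hΩ, ?_, ?_, ?_⟩
  · exact (memLp_indicator_iff_restrict hΩ).2 (hu.ae_eq hae)
  · filter_upwards [(ae_restrict_iff' hΩ).1 hae] with x hx hxΩ
    simp [hxΩ, hx hxΩ]
  · rw [eLpNorm_indicator_eq_eLpNorm_restrict hΩ]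
    exact eLpNorm_congr_ae hae.symm

theorem lintegral_diff_quotient_congr {Ω : Set (EuclideanSpace ℝ (Fin d))} (hΩ : IsOpen Ω)
    {k r ε : ℝ} (hrk : r ≤ k) (hε : 0 < ε) {u v : EuclideanSpace ℝ (Fin d) → 𝕜}
    (huv : ∀ᵐ x, x ∈ Ω → v x = u x) :
    ∫⁻ x in innerSet Ω (k * ε), ∫⁻ ξ in Metric.ball (0 : EuclideanSpace ℝ (Fin d)) r,
      ‖ε⁻¹ • (v (x + ε • ξ) - v x)‖ₑ ^ 2 =
    ∫⁻ x in innerSet Ω (k * ε), ∫⁻ ξ in Metric.ball (0 : EuclideanSpace ℝ (Fin d)) r,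
      ‖ε⁻¹ • (u (x + ε • ξ) - u x)‖ₑ ^ 2 := by
  refine lintegral_congr_ae ((ae_restrict_iff' (isOpen_innerSet hΩ _).measurableSet).2 ?_)
  filter_upwards [huv] with x hx hxA
  refine lintegral_congr_ae ((ae_restrict_iff' Metric.isOpen_ball.measurableSet).2 ?_)
  have hq : Measure.QuasiMeasurePreserving
      (fun ξ : EuclideanSpace ℝ (Fin d) => x + ε • ξ) volume volume :=
    (measurePreserving_add_left volume x).quasiMeasurePreserving.comp
      (Measure.quasiMeasurePreserving_smul volume hε.ne')
  filter_upwards [hq.ae huv] with ξ hξ hξr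
  rw [hx hxA.1, hξ]
  refine add_mem_of_mem_innerSet hΩ hxA ?_
  rw [norm_smul, Real.norm_of_nonneg hε.le, mul_comm]
  have : ‖ξ‖ < r := by simpa using hξr
  gcongr
  exact this.le.trans hrk

theorem exists_kernel (d : ℕ) {r : ℝ} (hr : 0 < r) :
    ∃ (φ : EuclideanSpace ℝ (Fin d) → ℝ) (K : ℝ≥0), ContDiff ℝ ∞ φ ∧ HasCompactSupport φ ∧
      ∫ ξ, φ ξ = 1 ∧ (∀ x, ‖φ x‖ₑ ≤ K) ∧ (∀ x ∉ Metric.ball 0 r, φ x = 0) ∧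
      ∀ i, (∀ x, ‖partials φ i x‖ₑ ≤ K) ∧ ∀ x ∉ Metric.ball 0 r, partials φ i x = 0 := by
  let f : ContDiffBump (0 : EuclideanSpace ℝ (Fin d)) :=
    { rIn := r / 4, rOut := r / 2, rIn_pos := by positivity, rIn_lt_rOut := by linarith }
  have hφ : ContDiff ℝ ∞ (f.normed volume) := f.contDiff_normed
  have hc : HasCompactSupport (f.normed volume) := f.hasCompactSupport_normed
  have hs : ∀ x ∉ Metric.ball (0 : EuclideanSpace ℝ (Fin d)) r, x ∉ tsupport (f.normed volume) := by
    intro x hx hx'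
    rw [f.tsupport_normed_eq] at hx'
    refine hx (Metric.closedBall_subset_ball ?_ hx')
    change r / 2 < r
    linarith
  obtain ⟨K₀, hK₀⟩ := hc.exists_bound_of_continuous hφ.continuous
  obtain ⟨K₁, hK₁⟩ := (hc.fderiv ℝ).exists_bound_of_continuous (hφ.continuous_fderiv (by simp))
  have hle {a b : ℝ} (h : a ≤ b) (h0 : 0 ≤ a) : ENNReal.ofReal a ≤ b.toNNReal :=
    ENNReal.ofReal_le_ofReal h
  refine ⟨f.normed volume, (max K₀ K₁).toNNReal, hφ, hc, f.integral_normed, fun x => ?_,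
    fun x hx => image_eq_zero_of_notMem_tsupport (hs x hx), fun i => ⟨fun x => ?_,
    fun x hx => partials_eq_zero_of_notMem_tsupport i (hs x hx)⟩⟩
  · rw [← ofReal_norm]
    exact hle ((hK₀ x).trans (le_max_left _ _)) (norm_nonneg _)
  · rw [← ofReal_norm]
    refine hle (le_trans ?_ ((hK₁ x).trans (le_max_right _ _))) (norm_nonneg _)
    refine (ContinuousLinearMap.le_opNorm _ _).trans ?_
    simp

/-- The smooth approximation at a fixed scale `ε`, with a constant depending only on the dimension
and the interaction radius. -/
theorem exists_contDiff_approx {Ω : Set (EuclideanSpace ℝ (Fin d))} (hΩ : IsOpen Ω) {k r : ℝ}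
    (hr : 0 < r) (hrk : r ≤ k) :
    ∃ C : ℝ, 0 < C ∧ ∀ (M : ℝ) (_ : 0 ≤ M) (ε : ℝ) (_ : 0 < ε)
      (u : EuclideanSpace ℝ (Fin d) → 𝕜) (_ : MemLp u 2 (volume.restrict Ω))
      (_ : ∫⁻ x in innerSet Ω (k * ε), ∫⁻ ξ in Metric.ball (0 : EuclideanSpace ℝ (Fin d)) r,
        ‖ε⁻¹ • (u (x + ε • ξ) - u x)‖ₑ ^ 2 ≤ ENNReal.ofReal M),
      ∃ w : EuclideanSpace ℝ (Fin d) → 𝕜, ContDiff ℝ ∞ w ∧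
        IsH1 (innerSet Ω (k * ε)) w (partials w) ∧
        eLpNorm (u - w) 2 (volume.restrict (innerSet Ω (k * ε))) ≤ ENNReal.ofReal (C * √M * ε) ∧
        h1Norm (innerSet Ω (k * ε)) w (partials w) ≤
          ENNReal.ofReal C * (ENNReal.ofReal (√M) + eLpNorm u 2 (volume.restrict Ω)) := by
  obtain ⟨φ, K, hφ, hφc, hφ1, hφK, hφs, hD⟩ := exists_kernel d hr
  set b : ℝ≥0 := (volume (Metric.ball (0 : EuclideanSpace ℝ (Fin d)) r)).toNNReal
  have hb : volume (Metric.ball (0 : EuclideanSpace ℝ (Fin d)) r) ≤ b :=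
    (ENNReal.coe_toNNReal measure_ball_lt_top.ne).ge
  set C₀ : ℝ≥0 := K * (1 + b) with hC₀
  have hC₀' : (K : ℝ≥0∞) * (1 + b) = C₀ := by simp [hC₀]
  refine ⟨(1 + d) * C₀ + 1, by positivity, fun M hM ε hε u hu hen => ?_⟩
  obtain ⟨v, hvm, hvL, hvu, hvn⟩ := exists_stronglyMeasurable_extension hΩ.measurableSet hu
  rw [← lintegral_diff_quotient_congr hΩ hrk hε hvu] at hen
  have hvloc := MemLp.locallyIntegrable_two hvL
  set A := innerSet Ω (k * ε) with hA
  have hAΩ : A ⊆ Ω := innerSet_subset _ _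
  have hsm := contDiff_mollify hε.ne' hφ hφc hvloc
  have hT1 : eLpNorm (mollify φ ε v) 2 volume ≤ C₀ * eLpNorm u 2 (volume.restrict Ω) := by
    refine (eLpNorm_mollify_le hφK hφs hb hvm).trans ?_
    rw [hvn, ← hC₀']
    gcongr
    exact le_add_self
  have hT2 : ∀ i, eLpNorm (partials (mollify φ ε v) i) 2 (volume.restrict A) ≤
      C₀ * ENNReal.ofReal (√M) := fun i => by
    have h1 := eLpNorm_mollify_sub_le hε (hφ.continuous_partials i)
      (hasCompactSupport_partials hφc i) (hD i).1 (hD i).2 hb hvL hvm hM hen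
    have h2 : ∫ ξ, partials φ i ξ = 0 := integral_fderiv_eq_zero hφ hφc _
    have h3 : partials (mollify φ ε v) i = (-ε⁻¹) • mollify (partials φ i) ε v := by
      ext x
      exact fderiv_mollify hε.ne' hφ hφc hvloc x _
    simp only [h2, zero_smul, sub_zero, hC₀'] at h1
    rw [h3, eLpNorm_const_smul, enorm_neg, Real.enorm_eq_ofReal (by positivity)]
    calc _ ≤ ENNReal.ofReal ε⁻¹ * (C₀ * ENNReal.ofReal (√M) * ENNReal.ofReal ε) := by
          gcongr
      _ = C₀ * ENNReal.ofReal (√M) * (ENNReal.ofReal ε⁻¹ * ENNReal.ofReal ε) := by ring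
      _ = _ := by
          rw [← ENNReal.ofReal_mul (by positivity), inv_mul_cancel₀ hε.ne']
          simp
  have hT1' : eLpNorm (mollify φ ε v) 2 (volume.restrict A) ≤
      C₀ * eLpNorm u 2 (volume.restrict Ω) :=
    (eLpNorm_mono_measure _ Measure.restrict_le_self).trans hT1
  have hu_top : eLpNorm u 2 (volume.restrict Ω) ≠ ⊤ := hu.2.ne
  have hCle : ((1 + d) * C₀ : ℝ≥0∞) ≤ ENNReal.ofReal ((1 + d) * C₀ + 1) := by
    rw [ENNReal.ofReal_add (by positivity) (by positivity), ENNReal.ofReal_mul (by positivity),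
      ENNReal.ofReal_add (by positivity) (by positivity)]
    simp
  refine ⟨mollify φ ε v, hsm, isH1_of_contDiff hsm
    ⟨hsm.continuous.aestronglyMeasurable, hT1'.trans_lt (by finiteness)⟩
    fun i => ⟨(hsm.continuous_partials i).aestronglyMeasurable, (hT2 i).trans_lt (by finiteness)⟩,
    ?_, ?_⟩
  · have h1 := eLpNorm_mollify_sub_le hε hφ.continuous hφc hφK hφs hb hvL hvm hM hen
    simp only [hφ1, one_smul, hC₀'] at h1
    have h2 : eLpNorm (u - mollify φ ε v) 2 (volume.restrict A) =
        eLpNorm (fun x => mollify φ ε v x - v x) 2 (volume.restrict A) := by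
      rw [eLpNorm_sub_comm]
      refine eLpNorm_congr_ae ((ae_restrict_iff' (isOpen_innerSet hΩ _).measurableSet).2 ?_)
      filter_upwards [hvu] with x hx hxA
      simp [hx (hAΩ hxA)]
    rw [h2]
    refine h1.trans ?_
    rw [ENNReal.ofReal_mul (by positivity), ENNReal.ofReal_mul (by positivity)]
    gcongr
    refine le_trans ?_ hCle
    exact le_mul_of_one_le_left zero_le le_self_add
  · refine (h1Norm_le (T := C₀ * (ENNReal.ofReal (√M) + eLpNorm u 2 (volume.restrict Ω)))
      (hT1'.trans ?_) fun i => (hT2 i).trans ?_).trans ?_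
    · gcongr
      exact le_add_self
    · gcongr
      exact le_self_add
    · rw [← mul_assoc]
      gcongr

end Approximation

section WeakConvergence

variable {𝕜 : Type*} [RCLike 𝕜] {d : ℕ}

theorem exists_subseq_weak_tendsto_L2 {ι : Type*} [Fintype ι]
    (F : ι → ℕ → EuclideanSpace ℝ (Fin d) → 𝕜) (hF : ∀ i n, MemLp (F i n) 2 volume) (B : ℝ≥0)
    (hB : ∀ i n, eLpNorm (F i n) 2 volume ≤ B) :
    ∃ (s : ℕ → ℕ) (f : ι → EuclideanSpace ℝ (Fin d) → 𝕜), StrictMono s ∧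
      ∀ i, StronglyMeasurable (f i) ∧ MemLp (f i) 2 volume ∧
        ∀ h : EuclideanSpace ℝ (Fin d) → 𝕜, MemLp h 2 volume →
          Tendsto (fun n => ∫ x, inner 𝕜 (h x) (F i (s n) x)) atTop
            (𝓝 (∫ x, inner 𝕜 (h x) (f i x))) := by
  have : Fact ((2 : ℝ≥0∞) ≠ ⊤) := ⟨by simp⟩
  obtain ⟨s, hs, hlim⟩ := exists_subseq_weak_tendsto_finset (𝕜 := 𝕜)
    (fun i n => (hF i n).toLp (F i n)) B (fun i n => MemLp.norm_toLp_le (hF i n) (hB i n))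
    Finset.univ
  choose a ha using fun i => hlim i (Finset.mem_univ i)
  refine ⟨s, fun i => a i, hs, fun i => ⟨Lp.stronglyMeasurable _, Lp.memLp _, fun h hh => ?_⟩⟩
  have := ha i (hh.toLp h)
  simp only [inner_toLp] at this
  rwa [← Lp.toLp_coeFn (a i) (Lp.memLp _), inner_toLp] at this

theorem setIntegral_inner_eq {s : Set (EuclideanSpace ℝ (Fin d))} (hs : MeasurableSet s)
    (f g : EuclideanSpace ℝ (Fin d) → 𝕜) :
    ∫ x in s, inner 𝕜 (f x) (g x) = ∫ x, inner 𝕜 (s.indicator f x) (g x) := by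
  rw [← integral_indicator hs]
  refine integral_congr_ae (Eventually.of_forall fun x => ?_)
  by_cases hx : x ∈ s <;> simp [hx]

theorem inner_ofReal_left (a : ℝ) (z : 𝕜) : inner 𝕜 (a : 𝕜) z = a • z := by
  rw [RCLike.inner_apply, RCLike.conj_ofReal, mul_comm, RCLike.real_smul_eq_coe_mul]

theorem memLp_ofReal_comp {q : EuclideanSpace ℝ (Fin d) → ℝ} (hq : Continuous q)
    (hqc : HasCompactSupport q) : MemLp (fun x => (q x : 𝕜)) 2 volume :=
  (RCLike.continuous_ofReal.comp hq).memLp_of_hasCompactSupport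
    (hqc.comp_left (g := fun t : ℝ => (t : 𝕜)) (by simp))

/-- The limit of a sequence which, together with its gradients on an exhausting sequence of
subsets, converges weakly in `L²` belongs to `H¹`. -/
theorem isH1_of_weak_tendsto {Ω : Set (EuclideanSpace ℝ (Fin d))}
    {A : ℕ → Set (EuclideanSpace ℝ (Fin d))} (hA : ∀ n, MeasurableSet (A n))
    (hAΩ : ∀ t, IsCompact t → t ⊆ Ω → ∀ᶠ n in atTop, t ⊆ A n)
    {w : ℕ → EuclideanSpace ℝ (Fin d) → 𝕜} {Dw : ℕ → Fin d → EuclideanSpace ℝ (Fin d) → 𝕜}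
    (hw : ∀ n, IsH1 (A n) (w n) (Dw n))
    {u : EuclideanSpace ℝ (Fin d) → 𝕜} {Du : Fin d → EuclideanSpace ℝ (Fin d) → 𝕜}
    (hu : MemLp u 2 volume) (hDu : ∀ i, MemLp (Du i) 2 volume)
    (hwu : ∀ h : EuclideanSpace ℝ (Fin d) → 𝕜, MemLp h 2 volume →
      Tendsto (fun n => ∫ x, inner 𝕜 (h x) ((A n).indicator (w n) x)) atTop
        (𝓝 (∫ x, inner 𝕜 (h x) (u x))))
    (hDwu : ∀ i, ∀ h : EuclideanSpace ℝ (Fin d) → 𝕜, MemLp h 2 volume →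
      Tendsto (fun n => ∫ x, inner 𝕜 (h x) ((A n).indicator (Dw n i) x)) atTop
        (𝓝 (∫ x, inner 𝕜 (h x) (Du i x)))) :
    IsH1 Ω u Du := by
  refine ⟨hu.restrict _, fun i => (hDu i).restrict _, fun i φ hφ hφc hφΩ => ?_⟩
  have hz : ∀ x ∉ Ω, φ x = 0 := fun x hx => image_eq_zero_of_notMem_tsupport fun hx' => hx (hφΩ hx')
  have hz' : ∀ x ∉ Ω, partials φ i x = 0 := fun x hx =>
    partials_eq_zero_of_notMem_tsupport i fun hx' => hx (hφΩ hx')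
  rw [setIntegral_eq_integral_of_forall_compl_eq_zero (fun x hx => by simp [hz' x hx]),
    setIntegral_eq_integral_of_forall_compl_eq_zero (fun x hx => by simp [hz x hx])]
  have hi (q : EuclideanSpace ℝ (Fin d) → ℝ) (n : ℕ) (g : EuclideanSpace ℝ (Fin d) → 𝕜) :
      ∫ x, q x • (A n).indicator g x = ∫ x in A n, q x • g x := by
    rw [← integral_indicator (hA n)]
    refine integral_congr_ae (Eventually.of_forall fun x => ?_)
    by_cases hx : x ∈ A n <;> simp [hx]
  have h1 := hwu _ (memLp_ofReal_comp (hφ.continuous_partials i) (hasCompactSupport_partials hφc i))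
  have h2 := (hDwu i _ (memLp_ofReal_comp hφ.continuous hφc)).neg
  simp only [inner_ofReal_left, hi] at h1 h2
  refine tendsto_nhds_unique h1 (h2.congr' ?_)
  filter_upwards [hAΩ _ hφc hφΩ] with n hn
  exact ((hw n).weak_deriv i φ hφ hφc hn).symm

end WeakConvergence

section Translation

variable {𝕜 : Type*} [RCLike 𝕜] {d : ℕ}

theorem enorm_sub_sq_le_lintegral_fderiv {w : EuclideanSpace ℝ (Fin d) → 𝕜} (hw : ContDiff ℝ ∞ w)
    (x z : EuclideanSpace ℝ (Fin d)) :
    ‖w (x + z) - w x‖ₑ ^ 2 ≤ ∫⁻ t in Set.Ioc (0 : ℝ) 1, ‖fderiv ℝ w (x + t • z) z‖ₑ ^ 2 := by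
  have hd : ∀ t : ℝ, HasDerivAt (fun t : ℝ => w (x + t • z)) (fderiv ℝ w (x + t • z) z) t := by
    intro t
    have h1 : HasDerivAt (fun t : ℝ => x + t • z) z t := by
      simpa using ((hasDerivAt_id t).smul_const z).const_add x
    exact ((hw.differentiable (by simp)) _).hasFDerivAt.comp_hasDerivAt t h1
  have hc : Continuous fun t : ℝ => fderiv ℝ w (x + t • z) z :=
    ((hw.continuous_fderiv (by simp)).comp (by fun_prop)).clm_apply continuous_const
  have h2 := intervalIntegral.integral_eq_sub_of_hasDerivAt (fun t _ => hd t)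
    (hc.intervalIntegrable 0 1)
  have h3 := enorm_setIntegral_smul_sq_le (μ := (volume : Measure ℝ)) (K := 1)
    (s := Set.Ioc (0 : ℝ) 1) (q := (Set.Ioc (0 : ℝ) 1).indicator 1)
    (f := fun t => fderiv ℝ w (x + t • z) z)
    (fun t => by by_cases ht : t ∈ Set.Ioc (0 : ℝ) 1 <;> simp [ht]) (fun t ht => by simp [ht])
    hc.aestronglyMeasurable
  have h4 : ∫ t, (Set.Ioc (0 : ℝ) 1).indicator (1 : ℝ → ℝ) t • fderiv ℝ w (x + t • z) z =
      w (x + z) - w x := by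
    rw [intervalIntegral.integral_of_le zero_le_one] at h2
    simp only [one_smul, zero_smul, add_zero] at h2
    rw [← h2, ← integral_indicator measurableSet_Ioc]
    refine integral_congr_ae (Eventually.of_forall fun t => ?_)
    by_cases ht : t ∈ Set.Ioc (0 : ℝ) 1 <;> simp [ht]
  rw [h4] at h3
  simpa using h3

theorem lintegral_diff_quotient_le {w : EuclideanSpace ℝ (Fin d) → 𝕜} (hw : ContDiff ℝ ∞ w)
    {A S : Set (EuclideanSpace ℝ (Fin d))} (hA : MeasurableSet A) (hS : MeasurableSet S)
    {δ : ℝ} (hδ : 0 < δ) (h : ∀ x ∈ S, ∀ z : EuclideanSpace ℝ (Fin d), ‖z‖ ≤ δ → x + z ∈ A) :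
    ∫⁻ x in S, ∫⁻ ξ in Metric.ball (0 : EuclideanSpace ℝ (Fin d)) 1,
      ‖δ⁻¹ • (A.indicator w (x + δ • ξ) - A.indicator w x)‖ₑ ^ 2 ≤
    volume (Metric.ball (0 : EuclideanSpace ℝ (Fin d)) 1) *
      eLpNorm (fderiv ℝ w) 2 (volume.restrict A) ^ 2 := by
  set H : EuclideanSpace ℝ (Fin d) → ℝ≥0∞ := A.indicator fun y => ‖fderiv ℝ w y‖ₑ ^ 2 with hH
  have hHm : Measurable H :=
    ((hw.continuous_fderiv (by simp)).measurable.enorm.pow_const 2).indicator hA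
  have hpt : ∀ x ∈ S, ∀ ξ ∈ Metric.ball (0 : EuclideanSpace ℝ (Fin d)) 1,
      ‖δ⁻¹ • (A.indicator w (x + δ • ξ) - A.indicator w x)‖ₑ ^ 2 ≤
        ∫⁻ t in Set.Ioc (0 : ℝ) 1, H (x + t • δ • ξ) := by
    intro x hx ξ hξ
    have hξ1 : ‖ξ‖ ≤ 1 := by simpa using (Metric.mem_ball.1 hξ).le
    have hz : ‖δ • ξ‖ ≤ δ := by
      rw [norm_smul, Real.norm_of_nonneg hδ.le]
      exact mul_le_of_le_one_right hδ.le hξ1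
    have hxA : x ∈ A := by simpa using h x hx 0 (by simpa using hδ.le)
    rw [Set.indicator_of_mem (h x hx _ hz), Set.indicator_of_mem hxA, enorm_smul, mul_pow]
    calc _ ≤ ‖δ⁻¹‖ₑ ^ 2 * ∫⁻ t in Set.Ioc (0 : ℝ) 1, ‖fderiv ℝ w (x + t • δ • ξ) (δ • ξ)‖ₑ ^ 2 := by
          gcongr
          exact enorm_sub_sq_le_lintegral_fderiv hw x (δ • ξ)
      _ = ∫⁻ t in Set.Ioc (0 : ℝ) 1, ‖δ⁻¹‖ₑ ^ 2 * ‖fderiv ℝ w (x + t • δ • ξ) (δ • ξ)‖ₑ ^ 2 :=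
          (lintegral_const_mul' _ _ (by finiteness)).symm
      _ ≤ _ := by
          refine setLIntegral_mono' measurableSet_Ioc fun t ht => ?_
          have htz : ‖t • δ • ξ‖ ≤ δ := by
            rw [norm_smul, Real.norm_of_nonneg ht.1.le]
            exact (mul_le_of_le_one_left (norm_nonneg _) ht.2).trans hz
          rw [hH, Set.indicator_of_mem (h x hx _ htz), ← mul_pow, ← enorm_smul, ← map_smul,
            inv_smul_smul₀ hδ.ne']
          gcongr
          rw [enorm_le_iff_norm_le]
          exact (ContinuousLinearMap.le_opNorm _ _).trans
            (mul_le_of_le_one_right (norm_nonneg _) hξ1)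
  have hm1 : Measurable fun p : (EuclideanSpace ℝ (Fin d) × EuclideanSpace ℝ (Fin d)) × ℝ =>
      H (p.1.1 + p.2 • δ • p.1.2) := hHm.comp (by fun_prop)
  have hm2 : Measurable fun p : EuclideanSpace ℝ (Fin d) × EuclideanSpace ℝ (Fin d) =>
      ∫⁻ t in Set.Ioc (0 : ℝ) 1, H (p.1 + t • δ • p.2) := hm1.lintegral_prod_right'
  calc _ ≤ ∫⁻ x in S, ∫⁻ ξ in Metric.ball (0 : EuclideanSpace ℝ (Fin d)) 1,
        ∫⁻ t in Set.Ioc (0 : ℝ) 1, H (x + t • δ • ξ) :=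
        setLIntegral_mono' hS fun x hx => setLIntegral_mono' measurableSet_ball (hpt x hx)
    _ ≤ ∫⁻ x, ∫⁻ ξ in Metric.ball (0 : EuclideanSpace ℝ (Fin d)) 1,
        ∫⁻ t in Set.Ioc (0 : ℝ) 1, H (x + t • δ • ξ) := setLIntegral_le_lintegral _ _
    _ = ∫⁻ ξ in Metric.ball (0 : EuclideanSpace ℝ (Fin d)) 1, ∫⁻ x,
        ∫⁻ t in Set.Ioc (0 : ℝ) 1, H (x + t • δ • ξ) :=
        lintegral_lintegral_swap (f := fun x ξ => ∫⁻ t in Set.Ioc (0 : ℝ) 1, H (x + t • δ • ξ))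
          hm2.aemeasurable
    _ = ∫⁻ ξ in Metric.ball (0 : EuclideanSpace ℝ (Fin d)) 1, ∫⁻ t in Set.Ioc (0 : ℝ) 1,
        ∫⁻ x, H (x + t • δ • ξ) := by
        refine lintegral_congr fun ξ => ?_
        exact lintegral_lintegral_swap (f := fun x t => H (x + t • δ • ξ))
          (hHm.comp (by fun_prop)).aemeasurable
    _ = _ := by
        have h1 (z : EuclideanSpace ℝ (Fin d)) : ∫⁻ x, H (x + z) = ∫⁻ x, H x :=
          lintegral_add_right_eq_self H z
        simp only [h1, eLpNorm_two_sq]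
        rw [hH, lintegral_indicator hA]
        simp [mul_comm]

theorem eLpNorm_fderiv_le {w : EuclideanSpace ℝ (Fin d) → 𝕜} (hw : ContDiff ℝ ∞ w)
    {μ : Measure (EuclideanSpace ℝ (Fin d))} {B : ℝ≥0∞}
    (h : ∀ i, eLpNorm (partials w i) 2 μ ≤ B) : eLpNorm (fderiv ℝ w) 2 μ ≤ d * B := by
  have hpt : ∀ x, ‖fderiv ℝ w x‖ ≤ ‖∑ i, ‖partials w i x‖‖ := by
    intro x
    rw [Real.norm_of_nonneg (by positivity)]
    refine ContinuousLinearMap.opNorm_le_bound _ (by positivity) fun z => ?_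
    have hz : z = ∑ i, z i • EuclideanSpace.single i (1 : ℝ) := by
      have := (EuclideanSpace.basisFun (Fin d) ℝ).sum_repr z
      simpa using this.symm
    conv_lhs => rw [hz]
    rw [map_sum, Finset.sum_mul]
    refine (norm_sum_le _ _).trans (Finset.sum_le_sum fun i _ => ?_)
    rw [map_smul, norm_smul, mul_comm]
    gcongr
    · exact le_rfl
    · exact PiLp.norm_apply_le z i
  have hsum : (fun x => ∑ i, ‖partials w i x‖) = ∑ i, fun x => ‖partials w i x‖ := by
    ext x
    simp
  calc eLpNorm (fderiv ℝ w) 2 μ ≤ eLpNorm (fun x => ∑ i, ‖partials w i x‖) 2 μ :=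
        eLpNorm_mono hpt
    _ ≤ ∑ i, eLpNorm (fun x => ‖partials w i x‖) 2 μ := by
        rw [hsum]
        exact eLpNorm_sum_le (fun i _ => (hw.continuous_partials i).norm.aestronglyMeasurable)
          one_le_two
    _ ≤ ∑ _i : Fin d, B := Finset.sum_le_sum fun i _ => by
        rw [eLpNorm_norm]
        exact h i
    _ = d * B := by simp

end Translation

section LocalCompactness

variable {𝕜 : Type*} [RCLike 𝕜] {d : ℕ}

theorem mollify_eq_integral_inner {ε : ℝ} (hε : ε ≠ 0) (q : EuclideanSpace ℝ (Fin d) → ℝ)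
    (v : EuclideanSpace ℝ (Fin d) → 𝕜) (x : EuclideanSpace ℝ (Fin d)) :
    mollify q ε v x = |(ε ^ d)⁻¹| • ∫ t, inner 𝕜 (q (ε⁻¹ • (t - x)) : 𝕜) (v t) := by
  have h1 := Measure.integral_comp_smul (μ := (volume : Measure (EuclideanSpace ℝ (Fin d))))
    (fun t => q (ε⁻¹ • t) • v (x + t)) ε
  rw [finrank_euclideanSpace_fin] at h1
  have h2 := integral_add_left_eq_self (μ := (volume : Measure (EuclideanSpace ℝ (Fin d))))
    (fun t => q (ε⁻¹ • (t - x)) • v t) x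
  simp only [inner_ofReal_left, ← h2, add_sub_cancel_left, ← h1, mollify]
  refine integral_congr_ae (Eventually.of_forall fun ξ => ?_)
  simp [hε]

theorem lintegral_comp_affine {ε : ℝ} (hε : ε ≠ 0) {F : EuclideanSpace ℝ (Fin d) → ℝ≥0∞}
    (hF : Measurable F) (x : EuclideanSpace ℝ (Fin d)) :
    ∫⁻ ξ, F (x + ε • ξ) = ENNReal.ofReal |(ε ^ d)⁻¹| * ∫⁻ t, F t := by
  have h1 := lintegral_map (μ := (volume : Measure (EuclideanSpace ℝ (Fin d))))
    (f := fun t => F (x + t)) (g := fun ξ => ε • ξ) (hF.comp (by fun_prop)) (by fun_prop)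
  rw [Measure.map_addHaar_smul _ hε, lintegral_smul_measure, finrank_euclideanSpace_fin,
    lintegral_add_left_eq_self] at h1
  exact h1.symm

theorem enorm_mollify_sq_le {q : EuclideanSpace ℝ (Fin d) → ℝ} {ε : ℝ} (hε : ε ≠ 0)
    {v : EuclideanSpace ℝ (Fin d) → 𝕜} {s : Set (EuclideanSpace ℝ (Fin d))} {K : ℝ≥0}
    (hK : ∀ x, ‖q x‖ₑ ≤ K) (hqs : ∀ x ∉ s, q x = 0) (hv : StronglyMeasurable v)
    (x : EuclideanSpace ℝ (Fin d)) :
    ‖mollify q ε v x‖ₑ ^ 2 ≤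
      K ^ 2 * volume s * (ENNReal.ofReal |(ε ^ d)⁻¹| * eLpNorm v 2 volume ^ 2) := by
  refine (enorm_setIntegral_smul_sq_le (μ := volume) (f := fun ξ => v (x + ε • ξ)) hK hqs
    (hv.comp_measurable (by fun_prop)).aestronglyMeasurable).trans ?_
  gcongr
  rw [eLpNorm_two_sq, ← lintegral_comp_affine hε (hv.enorm.pow_const 2) x]
  exact setLIntegral_le_lintegral _ _

variable {V : ℕ → EuclideanSpace ℝ (Fin d) → 𝕜} {u : EuclideanSpace ℝ (Fin d) → 𝕜}

theorem tendsto_mollify_of_weak {q : EuclideanSpace ℝ (Fin d) → ℝ} {ε : ℝ} (hε : ε ≠ 0)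
    (hq : Continuous q) (hqc : HasCompactSupport q)
    (hw : ∀ h : EuclideanSpace ℝ (Fin d) → 𝕜, MemLp h 2 volume →
      Tendsto (fun n => ∫ x, inner 𝕜 (h x) (V n x)) atTop (𝓝 (∫ x, inner 𝕜 (h x) (u x))))
    (x : EuclideanSpace ℝ (Fin d)) :
    Tendsto (fun n => mollify q ε (V n) x) atTop (𝓝 (mollify q ε u x)) := by
  simp only [mollify_eq_integral_inner hε]
  refine (hw (fun t => (q (ε⁻¹ • (t - x)) : 𝕜)) ?_).const_smul _
  refine memLp_ofReal_comp (hq.comp (by fun_prop)) ?_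
  exact (hqc.comp_const_smul (inv_ne_zero hε)).comp_homeomorph (Homeomorph.subRight x)

/-- Mollification turns weak `L²` convergence into strong convergence on sets of finite measure. -/
theorem tendsto_eLpNorm_mollify_of_weak {q : EuclideanSpace ℝ (Fin d) → ℝ} {ε : ℝ} (hε : ε ≠ 0)
    (hq : ContDiff ℝ ∞ q) (hqc : HasCompactSupport q)
    {s : Set (EuclideanSpace ℝ (Fin d))} {K : ℝ≥0}
    (hK : ∀ x, ‖q x‖ₑ ≤ K) (hqs : ∀ x ∉ s, q x = 0) (hs : volume s ≠ ⊤)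
    (hV : ∀ n, StronglyMeasurable (V n)) (hVL : ∀ n, MemLp (V n) 2 volume)
    {B : ℝ≥0} (hB : ∀ n, eLpNorm (V n) 2 volume ≤ B)
    (hu : StronglyMeasurable u) (huL : MemLp u 2 volume)
    (hw : ∀ h : EuclideanSpace ℝ (Fin d) → 𝕜, MemLp h 2 volume →
      Tendsto (fun n => ∫ x, inner 𝕜 (h x) (V n x)) atTop (𝓝 (∫ x, inner 𝕜 (h x) (u x))))
    {S : Set (EuclideanSpace ℝ (Fin d))} (hS : volume S ≠ ⊤) :
    Tendsto (fun n => eLpNorm (mollify q ε (V n) - mollify q ε u) 2 (volume.restrict S)) atTop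
      (𝓝 0) := by
  have hm (v : EuclideanSpace ℝ (Fin d) → 𝕜) (hv : MemLp v 2 volume) :
      Continuous (mollify q ε v) :=
    (contDiff_mollify hε hq hqc (MemLp.locallyIntegrable_two hv)).continuous
  have hsub : ∀ n, mollify q ε (V n) - mollify q ε u = mollify q ε (V n - u) := fun n => by
    ext x
    simp only [mollify, Pi.sub_apply, smul_sub]
    exact (integral_sub (integrable_smul_comp_affine hε hq.continuous hqc (hVL n) x)
      (integrable_smul_comp_affine hε hq.continuous hqc huL x)).symm
  have hb : ∀ n, eLpNorm (V n - u) 2 volume ≤ B + eLpNorm u 2 volume := fun n =>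
    (eLpNorm_sub_le (hVL n).1 huL.1 one_le_two).trans (by gcongr; exact hB n)
  set D : ℝ≥0∞ := K ^ 2 * volume s *
    (ENNReal.ofReal |(ε ^ d)⁻¹| * (B + eLpNorm u 2 volume) ^ 2) with hD
  have huT : eLpNorm u 2 volume ≠ ⊤ := huL.2.ne
  have hDT : D ≠ ⊤ := by finiteness
  have h2 : Tendsto (fun n => ∫⁻ x in S, ‖(mollify q ε (V n) - mollify q ε u) x‖ₑ ^ 2) atTop
      (𝓝 (∫⁻ _ in S, 0)) := by
    refine tendsto_lintegral_of_dominated_convergence (fun _ => D) (fun n => ?_) (fun n => ?_) ?_ ?_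
    · exact (((hm _ (hVL n)).sub (hm _ huL)).measurable.enorm).pow_const 2
    · refine Eventually.of_forall fun x => ?_
      simp only [hsub]
      refine (enorm_mollify_sq_le hε hK hqs ((hV n).sub hu) x).trans ?_
      rw [hD]
      gcongr
      exact hb n
    · simp only [lintegral_const, Measure.restrict_apply, MeasurableSet.univ, Set.univ_inter]
      finiteness
    · refine Eventually.of_forall fun x => ?_
      have h3 := (tendsto_mollify_of_weak hε hq.continuous hqc hw x).sub_const (mollify q ε u x)
      rw [sub_self] at h3
      simpa [Function.comp_def] using (ENNReal.continuous_pow 2).tendsto _ |>.comp h3.enorm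
  have h3 := ((ENNReal.continuous_rpow_const (y := (1 / 2 : ℝ))).tendsto _).comp h2
  simp only [lintegral_zero, one_div, inv_pos, Nat.ofNat_pos, ENNReal.zero_rpow_of_pos] at h3
  refine h3.congr fun n => ?_
  simp only [Function.comp]
  rw [← eLpNorm_two_sq, ← ENNReal.rpow_natCast, ← ENNReal.rpow_mul]
  simp

/-- Local Rellich theorem: `L²` weakly convergent smooth functions with bounded gradients on
neighbourhoods of a set of finite measure converge strongly on that set. -/
theorem tendsto_eLpNorm_of_weak_of_gradient {w : ℕ → EuclideanSpace ℝ (Fin d) → 𝕜}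
    {A : ℕ → Set (EuclideanSpace ℝ (Fin d))} (hA : ∀ n, MeasurableSet (A n))
    (hw : ∀ n, ContDiff ℝ ∞ (w n)) {B G : ℝ≥0}
    (hB : ∀ n, eLpNorm (w n) 2 (volume.restrict (A n)) ≤ B)
    (hG : ∀ n, eLpNorm (fderiv ℝ (w n)) 2 (volume.restrict (A n)) ≤ G)
    (hu : StronglyMeasurable u) (huL : MemLp u 2 volume)
    (hwu : ∀ h : EuclideanSpace ℝ (Fin d) → 𝕜, MemLp h 2 volume →
      Tendsto (fun n => ∫ x, inner 𝕜 (h x) ((A n).indicator (w n) x)) atTop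
        (𝓝 (∫ x, inner 𝕜 (h x) (u x))))
    {S : Set (EuclideanSpace ℝ (Fin d))} (hS : MeasurableSet S) (hSv : volume S ≠ ⊤)
    {δ₀ : ℝ} (hδ₀ : 0 < δ₀)
    (hSA : ∀ᶠ n in atTop, ∀ x ∈ S, ∀ z : EuclideanSpace ℝ (Fin d), ‖z‖ ≤ δ₀ → x + z ∈ A n) :
    Tendsto (fun n => eLpNorm ((A n).indicator (w n) - u) 2 (volume.restrict S)) atTop (𝓝 0) := by
  set V : ℕ → EuclideanSpace ℝ (Fin d) → 𝕜 := fun n => (A n).indicator (w n) with hV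
  have hVm : ∀ n, StronglyMeasurable (V n) := fun n =>
    (hw n).continuous.stronglyMeasurable.indicator (hA n)
  have hVB : ∀ n, eLpNorm (V n) 2 volume ≤ B := fun n => by
    rw [hV, eLpNorm_indicator_eq_eLpNorm_restrict (hA n)]
    exact hB n
  have hVL : ∀ n, MemLp (V n) 2 volume := fun n =>
    ⟨(hVm n).aestronglyMeasurable, (hVB n).trans_lt ENNReal.coe_lt_top⟩
  rw [← Lp.tendsto_Lp_iff_tendsto_eLpNorm'' V (fun n => (hVL n).restrict S) u (huL.restrict S)]
  refine tendsto_of_weak_tendsto_of_approx (𝕜 := 𝕜) (fun y => ?_) fun η hη => ?_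
  · rw [← Lp.toLp_coeFn y (Lp.memLp _)]
    simp only [inner_toLp, setIntegral_inner_eq hS]
    exact hwu _ ((memLp_indicator_iff_restrict hS).2 (Lp.memLp y))
  obtain ⟨φ, K, hφ, hφc, hφ1, hφK, hφs, -⟩ := exists_kernel d one_pos
  set b : ℝ≥0 := (volume (Metric.ball (0 : EuclideanSpace ℝ (Fin d)) 1)).toNNReal
  have hb : volume (Metric.ball (0 : EuclideanSpace ℝ (Fin d)) 1) ≤ b :=
    (ENNReal.coe_toNNReal measure_ball_lt_top.ne).ge
  set M : ℝ := b * G ^ 2 with hM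
  obtain ⟨δ, hδ, hδδ₀, hδη⟩ : ∃ δ > 0, δ ≤ δ₀ ∧ K * (1 + b) * √M * δ ≤ η := by
    set c : ℝ := K * (1 + b) * √M with hc
    have hc0 : 0 ≤ c := by positivity
    refine ⟨min δ₀ (η / (c + 1)), by positivity, min_le_left _ _, ?_⟩
    calc c * min δ₀ (η / (c + 1)) ≤ (c + 1) * (η / (c + 1)) := by
          gcongr
          · linarith
          · exact min_le_right _ _
      _ = η := by field_simp
  have hmem (v : EuclideanSpace ℝ (Fin d) → 𝕜) (hv : StronglyMeasurable v)
      (hvL : MemLp v 2 volume) : MemLp (mollify φ δ v) 2 (volume.restrict S) := by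
    have hvT : eLpNorm v 2 volume ≠ ⊤ := hvL.2.ne
    exact MemLp.restrict _ ⟨(contDiff_mollify hδ.ne' hφ hφc
      (MemLp.locallyIntegrable_two hvL)).continuous.aestronglyMeasurable,
      (eLpNorm_mollify_le hφK hφs hb hv).trans_lt (by finiteness)⟩
  refine ⟨fun n => (hmem _ (hVm n) (hVL n)).toLp _, (hmem u hu huL).toLp _, ?_, ?_⟩
  · rw [Lp.tendsto_Lp_iff_tendsto_eLpNorm'']
    exact tendsto_eLpNorm_mollify_of_weak hδ.ne' hφ hφc hφK hφs measure_ball_lt_top.ne hVm hVL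
      hVB hu huL hwu hSv
  · filter_upwards [hSA] with n hn
    rw [← MemLp.toLp_sub, Lp.norm_toLp]
    refine ENNReal.toReal_le_of_le_ofReal hη.le ?_
    have h1 := lintegral_diff_quotient_le (hw n) (hA n) hS hδ
      (fun x hx z hz => hn x hx z (hz.trans hδδ₀))
    have h2 : volume (Metric.ball (0 : EuclideanSpace ℝ (Fin d)) 1) *
        eLpNorm (fderiv ℝ (w n)) 2 (volume.restrict (A n)) ^ 2 ≤ ENNReal.ofReal M := by
      have : ENNReal.ofReal M = b * G ^ 2 := by
        rw [hM, ENNReal.ofReal_mul (by positivity), ENNReal.ofReal_pow (by positivity)]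
        simp
      rw [this]
      gcongr
      exact hG n
    have h3 := eLpNorm_mollify_sub_le hδ hφ.continuous hφc hφK hφs hb (hVL n) (hVm n)
      (by positivity) (h1.trans h2)
    simp only [hφ1, one_smul] at h3
    rw [eLpNorm_sub_comm]
    refine h3.trans (le_trans (le_of_eq ?_) (ENNReal.ofReal_le_ofReal hδη))
    rw [ENNReal.ofReal_mul (by positivity), ENNReal.ofReal_mul (by positivity),
      ENNReal.ofReal_mul (by positivity), ENNReal.ofReal_add (by positivity) (by positivity)]
    simp

/-- Functions which are bounded in `H¹` of an exhausting sequence of subsets of `Ω` have a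
subsequence converging strongly in `L²` and weakly in `H¹` on relatively compact subsets. -/
theorem exists_subseq_tendsto_local_H1 {Ω : Set (EuclideanSpace ℝ (Fin d))} (hΩ : IsOpen Ω)
    {A : ℕ → Set (EuclideanSpace ℝ (Fin d))} (hA : ∀ n, MeasurableSet (A n))
    (hAΩ : ∀ t, IsCompact t → t ⊆ Ω → ∀ᶠ n in atTop, t ⊆ A n)
    {w : ℕ → EuclideanSpace ℝ (Fin d) → 𝕜} (hw : ∀ n, ContDiff ℝ ∞ (w n))
    (hw1 : ∀ n, IsH1 (A n) (w n) (partials (w n))) {B : ℝ≥0}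
    (hB : ∀ n, h1Norm (A n) (w n) (partials (w n)) ≤ B) :
    ∃ (s : ℕ → ℕ) (u : EuclideanSpace ℝ (Fin d) → 𝕜)
      (Du : Fin d → EuclideanSpace ℝ (Fin d) → 𝕜), StrictMono s ∧ MemLp u 2 volume ∧ IsH1 Ω u Du ∧
      ∀ Ω' : Set (EuclideanSpace ℝ (Fin d)), IsOpen Ω' → IsCompact (closure Ω') → closure Ω' ⊆ Ω →
        Tendsto (fun n => eLpNorm (w (s n) - u) 2 (volume.restrict Ω')) atTop (𝓝 0) ∧
        WeakTendstoH1 Ω' (fun n => w (s n)) (fun n => partials (w (s n))) u Du := by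
  have hB0 := fun n => ((eLpNorm_le_h1Norm (A n) (w n) (partials (w n))).1.trans (hB n))
  have hB1 := fun n i => ((eLpNorm_le_h1Norm (A n) (w n) (partials (w n))).2 i).trans (hB n)
  let F : Option (Fin d) → ℕ → EuclideanSpace ℝ (Fin d) → 𝕜 := fun i n =>
    (A n).indicator (i.elim (w n) (partials (w n)))
  have hFL : ∀ i n, MemLp (F i n) 2 volume := by
    rintro (_ | i) n
    · exact (memLp_indicator_iff_restrict (hA n)).2 (hw1 n).memLp
    · exact (memLp_indicator_iff_restrict (hA n)).2 ((hw1 n).grad_memLp i)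
  have hFB : ∀ i n, eLpNorm (F i n) 2 volume ≤ B := by
    rintro (_ | i) n
    · exact (eLpNorm_indicator_eq_eLpNorm_restrict (hA n)).trans_le (hB0 n)
    · exact (eLpNorm_indicator_eq_eLpNorm_restrict (hA n)).trans_le (hB1 n i)
  obtain ⟨s, f, hs, hf⟩ := exists_subseq_weak_tendsto_L2 F hFL B hFB
  have hsub : ∀ t, IsCompact t → t ⊆ Ω → ∀ᶠ n in atTop, t ⊆ A (s n) := fun t ht htΩ =>
    hs.tendsto_atTop.eventually (hAΩ t ht htΩ)
  have hweak : ∀ h : EuclideanSpace ℝ (Fin d) → 𝕜, MemLp h 2 volume →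
      Tendsto (fun n => ∫ x, inner 𝕜 (h x) ((A (s n)).indicator (w (s n)) x)) atTop
        (𝓝 (∫ x, inner 𝕜 (h x) (f none x))) := (hf none).2.2
  have hweak' : ∀ i, ∀ h : EuclideanSpace ℝ (Fin d) → 𝕜, MemLp h 2 volume →
      Tendsto (fun n => ∫ x, inner 𝕜 (h x) ((A (s n)).indicator (partials (w (s n)) i) x)) atTop
        (𝓝 (∫ x, inner 𝕜 (h x) (f (some i) x))) := fun i => (hf (some i)).2.2
  have hH1 : IsH1 Ω (f none) (fun i => f (some i)) :=
    isH1_of_weak_tendsto (fun n => hA (s n)) hsub (fun n => hw1 (s n)) (hf none).2.1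
      (fun i => (hf (some i)).2.1) hweak hweak'
  refine ⟨s, f none, fun i => f (some i), hs, (hf none).2.1, hH1, fun Ω' hΩ' hc hcΩ => ?_⟩
  have hev : ∀ᶠ n in atTop, Ω' ⊆ A (s n) :=
    (hsub _ hc hcΩ).mono fun n hn => subset_closure.trans hn
  refine ⟨?_, hev.mono fun n hn => (hw1 (s n)).mono hn, hH1.mono (subset_closure.trans hcΩ),
    fun v Dv hv => ?_⟩
  · obtain ⟨δ₀, hδ₀, hth⟩ := hc.exists_cthickening_subset_open hΩ hcΩ
    have h1 := tendsto_eLpNorm_of_weak_of_gradient (fun n => hA (s n)) (fun n => hw (s n))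
      (B := B) (G := d * B) (fun n => hB0 (s n))
      (fun n => (eLpNorm_fderiv_le (hw (s n)) (hB1 (s n))).trans (by simp)) (hf none).1
      (hf none).2.1 hweak hΩ'.measurableSet
      ((measure_mono subset_closure).trans_lt hc.measure_lt_top).ne hδ₀ (by
        filter_upwards [hsub _ hc.cthickening hth] with n hn x hx z hz
        exact hn (Metric.mem_cthickening_of_dist_le _ x _ _ (subset_closure hx) (by simpa using hz)))
    refine h1.congr' ?_
    filter_upwards [hev] with n hn
    refine eLpNorm_congr_ae ((ae_restrict_iff' hΩ'.measurableSet).2 (Eventually.of_forall ?_))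
    intro x hx
    simp [hn hx]
  · have key : ∀ (g : ℕ → EuclideanSpace ℝ (Fin d) → 𝕜) (g₀ h : EuclideanSpace ℝ (Fin d) → 𝕜),
        MemLp h 2 (volume.restrict Ω') →
        (∀ h : EuclideanSpace ℝ (Fin d) → 𝕜, MemLp h 2 volume →
          Tendsto (fun n => ∫ x, inner 𝕜 (h x) ((A (s n)).indicator (g n) x)) atTop
            (𝓝 (∫ x, inner 𝕜 (h x) (g₀ x)))) →
        Tendsto (fun n => ∫ x in Ω', inner 𝕜 (h x) (g n x)) atTop
          (𝓝 (∫ x in Ω', inner 𝕜 (h x) (g₀ x))) := by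
      intro g g₀ h hh hg
      rw [setIntegral_inner_eq hΩ'.measurableSet]
      refine (hg _ ((memLp_indicator_iff_restrict hΩ'.measurableSet).2 hh)).congr' ?_
      filter_upwards [hev] with n hn
      rw [← setIntegral_inner_eq hΩ'.measurableSet]
      refine setIntegral_congr_fun hΩ'.measurableSet fun x hx => ?_
      simp only [Set.indicator_of_mem (hn hx)]
    exact (key _ _ v hv.memLp hweak).add
      (tendsto_finsetSum _ fun i _ => key _ _ (Dv i) (hv.grad_memLp i) (hweak' i))

end LocalCompactness

theorem theoremB1 {𝕜 : Type*} [RCLike 𝕜] {d : ℕ} (Ω : Set (EuclideanSpace ℝ (Fin d)))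
    (hΩ : IsOpen Ω) (hLip : HasLipschitzBoundary Ω) (k r : ℝ) (hr : 0 < r) (hrk : r ≤ k) :
    ∃ C : ℝ, 0 < C ∧
      ∀ (M : ℝ) (_ : 0 ≤ M) (I : Set ℝ) (_ : I ⊆ Set.Ioi 0)
        (u : ℝ → EuclideanSpace ℝ (Fin d) → 𝕜)
        (_ : ∀ ε ∈ I, MemLp (u ε) 2 (volume.restrict Ω))
        (_ : ∃ K : ℝ≥0, ∀ ε ∈ I, eLpNorm (u ε) 2 (volume.restrict Ω) ≤ K)
        (_ : ∀ ε ∈ I,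
          ∫⁻ x in innerSet Ω (k * ε), ∫⁻ ξ in Metric.ball (0 : EuclideanSpace ℝ (Fin d)) r,
            ‖ε⁻¹ • (u ε (x + ε • ξ) - u ε x)‖ₑ ^ 2 ≤ ENNReal.ofReal M),
        ∃ w : ℝ → EuclideanSpace ℝ (Fin d) → 𝕜,
          (∀ ε ∈ I,
            ContDiffOn ℝ ∞ (w ε) (innerSet Ω (k * ε)) ∧
            IsH1 (innerSet Ω (k * ε)) (w ε) (partials (w ε)) ∧
            eLpNorm (u ε - w ε) 2 (volume.restrict (innerSet Ω (k * ε))) ≤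
              ENNReal.ofReal (C * √M * ε) ∧
            h1Norm (innerSet Ω (k * ε)) (w ε) (partials (w ε)) ≤
              ENNReal.ofReal C *
                (ENNReal.ofReal (√M) + eLpNorm (u ε) 2 (volume.restrict Ω))) ∧
          (∃ B : ℝ≥0, ∀ ε ∈ I, h1Norm (innerSet Ω (k * ε)) (w ε) (partials (w ε)) ≤ B) ∧
          ∀ e : ℕ → ℝ, (∀ n, e n ∈ I) → Tendsto e atTop (𝓝 0) →
            ∃ (s : ℕ → ℕ) (u₀ : EuclideanSpace ℝ (Fin d) → 𝕜)
              (Du₀ : Fin d → EuclideanSpace ℝ (Fin d) → 𝕜),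
              StrictMono s ∧ IsH1 Ω u₀ Du₀ ∧
              ∀ Ω' : Set (EuclideanSpace ℝ (Fin d)),
                IsOpen Ω' → IsCompact (closure Ω') → closure Ω' ⊆ Ω →
                Tendsto (fun n => eLpNorm (u (e (s n)) - u₀) 2 (volume.restrict Ω'))
                  atTop (𝓝 0) ∧
                Tendsto (fun n => eLpNorm (w (e (s n)) - u₀) 2 (volume.restrict Ω'))
                  atTop (𝓝 0) ∧
                WeakTendstoH1 Ω' (fun n => w (e (s n))) (fun n => partials (w (e (s n))))
                  u₀ Du₀ := by
  obtain ⟨C, hC, hw⟩ := exists_contDiff_approx (𝕜 := 𝕜) hΩ hr hrk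
  have hk : 0 < k := hr.trans_le hrk
  refine ⟨C, hC, fun M hM I hI u hu ⟨K, hK⟩ hen => ?_⟩
  choose! w hwc hw1 hwu hwn using fun ε (hε : ε ∈ I) => hw M hM ε (hI hε) (u ε) (hu ε hε) (hen ε hε)
  have hB : ∀ ε ∈ I, h1Norm (innerSet Ω (k * ε)) (w ε) (partials (w ε)) ≤
      (C.toNNReal * ((√M).toNNReal + K) : ℝ≥0) := fun ε hε => by
    refine (hwn ε hε).trans ?_
    push_cast
    exact mul_le_mul_right (add_le_add_right (hK ε hε) _) _
  refine ⟨w, fun ε hε => ⟨(hwc ε hε).contDiffOn, hw1 ε hε, hwu ε hε, hwn ε hε⟩, ⟨_, hB⟩,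
    fun e he he0 => ?_⟩
  have hsub : ∀ t, IsCompact t → t ⊆ Ω → ∀ᶠ n in atTop, t ⊆ innerSet Ω (k * e n) := by
    intro t ht htΩ
    obtain ⟨ρ₀, hρ₀, h⟩ := ht.eventually_subset_innerSet hΩ htΩ
    have h0 : Tendsto (fun n => k * e n) atTop (𝓝 0) := by simpa using he0.const_mul k
    exact (h0.eventually_lt_const hρ₀).mono fun n hn => h _ hn
  obtain ⟨s, u₀, Du₀, hs, hu₀, hH1, hlim⟩ := exists_subseq_tendsto_local_H1 hΩ
    (fun n => (isOpen_innerSet hΩ (k * e n)).measurableSet) hsub (fun n => hwc (e n) (he n))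
    (fun n => hw1 (e n) (he n)) (fun n => hB (e n) (he n))
  refine ⟨s, u₀, Du₀, hs, hH1, fun Ω' hΩ' hc hcΩ => ⟨?_, hlim Ω' hΩ' hc hcΩ⟩⟩
  have h1 := (hlim Ω' hΩ' hc hcΩ).1
  have h2 : Tendsto (fun n => ENNReal.ofReal (C * √M * e (s n))) atTop (𝓝 0) := by
    simpa using ENNReal.tendsto_ofReal ((he0.comp hs.tendsto_atTop).const_mul (C * √M))
  have h3 := h2.add h1
  rw [add_zero] at h3
  refine tendsto_of_tendsto_of_tendsto_of_le_of_le' tendsto_const_nhds h3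
    (Eventually.of_forall fun _ => zero_le) ?_
  filter_upwards [hs.tendsto_atTop.eventually (hsub _ hc hcΩ)] with n hn
  have hwm := (hwc (e (s n)) (he _)).continuous.aestronglyMeasurable (μ := volume.restrict Ω')
  have hum : AEStronglyMeasurable (u (e (s n))) (volume.restrict Ω') :=
    (hu _ (he (s n))).1.mono_measure (Measure.restrict_mono (subset_closure.trans hcΩ) le_rfl)
  calc eLpNorm (u (e (s n)) - u₀) 2 (volume.restrict Ω')
      = eLpNorm ((u (e (s n)) - w (e (s n))) + (w (e (s n)) - u₀)) 2 (volume.restrict Ω') := by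
        rw [sub_add_sub_cancel]
    _ ≤ eLpNorm (u (e (s n)) - w (e (s n))) 2 (volume.restrict Ω') +
        eLpNorm (w (e (s n)) - u₀) 2 (volume.restrict Ω') :=
        eLpNorm_add_le (hum.sub hwm) (hwm.sub hu₀.1.restrict) one_le_two
    _ ≤ _ := by
        gcongr
        exact (eLpNorm_mono_measure _ (Measure.restrict_mono (subset_closure.trans hn) le_rfl)).trans
          (hwu _ (he (s n)))
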